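/- Let $X$ be a complex manifold, $A\subset X$ a complex submanifold of codimension one, $TA$ and $TX$ the holomorphic tangent bundles, $N=TX|_A/TA$ the normal bundle of $A$ in $X$ (a holomorphic line bundle on $A$) and $N^{-1}$ its dual. Assume that the sheaf cohomology group $H^1(A, N^{-1}\otimes TA)$ of the sheaf of holomorphic sections of $N^{-1}\otimes TA$ vanishes. Then the exact sequence of holomorphic vector bundles $$0\to TA\to TX|_A\to N\to 0$$ splits: there is an isomorphism of holomorphic vector bundles $TX|_A\cong N\oplus TA$ on $A$ which carries the subbundle $TA\subset TX|_A$ identically to the summand $TA$ and whose component in $N$ is the quotient map $TX|_A\to N$. -/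

import Mathlib

open CategoryTheory TopologicalSpace Bundle Manifold
open scoped ContDiff TensorProduct Topology

set_option linter.unusedSectionVars false

universe u v
noncomputable section

section
variable {EX EA : Type} [NormedAddCommGroup EX] [NormedSpace ℂ EX]
  [NormedAddCommGroup EA] [NormedSpace ℂ EA]
  {X : Type v} [TopologicalSpace X] [ChartedSpace EX X]
  {A : Type u} [TopologicalSpace A] [ChartedSpace EA A]

/-- The holomorphic map `ι : A → X` of complex manifolds (modelled on `EA` and `EX`) is the
inclusion of a complex submanifold of codimension one: a topological embedding that in suitable
holomorphic charts is a linear inclusion `u ↦ (u, 0)`, with `dim X = dim A + 1`. -/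
structure IsHypersurface (ι : ContMDiffMap 𝓘(ℂ, EA) 𝓘(ℂ, EX) A X ω) : Prop where
  isEmbedding : IsSmoothEmbedding 𝓘(ℂ, EA) 𝓘(ℂ, EX) ω ι
  codim : Module.finrank ℂ EX = Module.finrank ℂ EA + 1

namespace IsHypersurface

variable {ι : ContMDiffMap 𝓘(ℂ, EA) 𝓘(ℂ, EX) A X ω}

/-- The differential of the inclusion is injective. -/
theorem mfderiv_injective [IsManifold 𝓘(ℂ, EX) ω X] [IsManifold 𝓘(ℂ, EA) ω A]
    (hι : IsHypersurface ι) (a : A) :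
    Function.Injective (mfderiv 𝓘(ℂ, EA) 𝓘(ℂ, EX) ι a) := by
  have h := (hι.isEmbedding.isImmersion.isImmersionAt a)
  set φ := h.domChart
  set ψ := h.codChart
  let e := h.equiv
  let p : EX → EA := fun y ↦ (e.symm y).1
  let r : X → A := fun x ↦ φ.symm (p (ψ x))
  have hfa : ι a ∈ ψ.source := h.mem_codChart_source
  have key : ∀ b ∈ φ.source, p (ψ (ι b)) = φ b := by
    intro b hb
    have hw := h.writtenInCharts
    have hb' : φ b ∈ (φ.extend 𝓘(ℂ, EA)).target := by simpa using φ.map_source hb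
    have := hw hb'
    simp only [p]
    have h2 : φ.symm (φ b) = b := φ.left_inv hb
    have h3 : ψ (ι b) = e (φ b, 0) := by
      have h4 : ψ (ι (φ.symm (φ b))) = e (φ b, 0) := by simpa using this
      rwa [h2] at h4
    rw [h3]; simp
  have hr : MDifferentiableAt 𝓘(ℂ, EX) 𝓘(ℂ, EA) r (ι a) := by
    have h1 : ContMDiffAt 𝓘(ℂ, EX) 𝓘(ℂ, EX) ω ψ (ι a) :=
      (contMDiffOn_of_mem_maximalAtlas h.codChart_mem_maximalAtlas).contMDiffAt
        (ψ.open_source.mem_nhds hfa)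
    have h2 : ContMDiff 𝓘(ℂ, EX) 𝓘(ℂ, EA) ω p := by
      rw [contMDiff_iff_contDiff]
      exact contDiff_fst.comp e.symm.contDiff
    have h3 : ContMDiffAt 𝓘(ℂ, EA) 𝓘(ℂ, EA) ω φ.symm (p (ψ (ι a))) := by
      rw [key a h.mem_domChart_source]
      exact (contMDiffOn_symm_of_mem_maximalAtlas h.domChart_mem_maximalAtlas).contMDiffAt
        (φ.open_target.mem_nhds (φ.map_source h.mem_domChart_source))
    exact (ContMDiffAt.comp (ι a) h3 (h2.contMDiffAt.comp _ h1)).mdifferentiableAt (by simp)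
  have hid : r ∘ ι =ᶠ[𝓝 a] id := by
    filter_upwards [φ.open_source.mem_nhds h.mem_domChart_source] with b hb
    simp only [Function.comp, r, key b hb, φ.left_inv hb, id]
  have hc := mfderiv_comp a hr (ι.contMDiff.mdifferentiableAt (by simp) (x := a))
  rw [hid.mfderiv_eq, mfderiv_id] at hc
  intro v w hvw
  have := congrArg (fun L ↦ L v) hc
  have h' := congrArg (fun L ↦ L w) hc
  simp only [ContinuousLinearMap.comp_apply] at this h'
  rw [hvw] at this
  exact (this.trans h'.symm : _)


variable (hι : IsHypersurface ι)

/-- The fibre `N_a = T_aX / T_aA` of the normal bundle. -/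
def Normal (_ : IsHypersurface ι) (a : A) : Type :=
  TangentSpace 𝓘(ℂ, EX) (ι a) ⧸ (mfderiv 𝓘(ℂ, EA) 𝓘(ℂ, EX) ι a).range

instance (a : A) : AddCommGroup (hι.Normal a) := inferInstanceAs (AddCommGroup (_ ⧸ _))
instance (a : A) : Module ℂ (hι.Normal a) := inferInstanceAs (Module ℂ (_ ⧸ _))
instance (a : A) : TopologicalSpace (hι.Normal a) := inferInstanceAs (TopologicalSpace (_ ⧸ _))
instance (a : A) : IsTopologicalAddGroup (hι.Normal a) :=
  inferInstanceAs (IsTopologicalAddGroup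
    (TangentSpace 𝓘(ℂ, EX) (ι a) ⧸ (mfderiv 𝓘(ℂ, EA) 𝓘(ℂ, EX) ι a).range))
instance (a : A) : ContinuousSMul ℂ (hι.Normal a) :=
  inferInstanceAs (ContinuousSMul ℂ
    (TangentSpace 𝓘(ℂ, EX) (ι a) ⧸ (mfderiv 𝓘(ℂ, EA) 𝓘(ℂ, EX) ι a).range))

/-- The projection `T_aX → N_a`. -/
def toNormal (a : A) : TangentSpace 𝓘(ℂ, EX) (ι a) →L[ℂ] hι.Normal a :=
  (mfderiv 𝓘(ℂ, EA) 𝓘(ℂ, EX) ι a).range.mkQL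

variable [IsManifold 𝓘(ℂ, EX) ω X] [IsManifold 𝓘(ℂ, EA) ω A]
variable [FiniteDimensional ℂ EX] [FiniteDimensional ℂ EA]


instance (a : A) : T2Space (hι.Normal a) := by
  have : FiniteDimensional ℂ (TangentSpace 𝓘(ℂ, EX) (ι a)) :=
    inferInstanceAs (FiniteDimensional ℂ EX)
  have : T2Space (TangentSpace 𝓘(ℂ, EX) (ι a)) := inferInstanceAs (T2Space EX)
  have : IsClosed ((mfderiv 𝓘(ℂ, EA) 𝓘(ℂ, EX) ι a).range : Set (TangentSpace 𝓘(ℂ, EX) (ι a))) :=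
    Submodule.closed_of_finiteDimensional _
  exact inferInstanceAs (T2Space
    (TangentSpace 𝓘(ℂ, EX) (ι a) ⧸ (mfderiv 𝓘(ℂ, EA) 𝓘(ℂ, EX) ι a).range))

variable (ι) in
/-- The differential of `ι` at `a`, in the tangent coordinates of the charts at `a₀` and `ι a₀`. -/
def diffCoord (a₀ a : A) : EA →L[ℂ] EX :=
  inTangentCoordinates 𝓘(ℂ, EA) 𝓘(ℂ, EX) id ι (mfderiv 𝓘(ℂ, EA) 𝓘(ℂ, EX) ι) a₀ a

theorem diffCoord_apply (a₀ a : A) (u : EA) :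
    diffCoord ι a₀ a u = (trivializationAt EX (TangentSpace 𝓘(ℂ, EX)) (ι a₀)).continuousLinearMapAt
      ℂ (ι a) (mfderiv 𝓘(ℂ, EA) 𝓘(ℂ, EX) ι a
        ((trivializationAt EA (TangentSpace 𝓘(ℂ, EA)) a₀).symmL ℂ a u)) := rfl

theorem contMDiffAt_diffCoord (a₀ : A) :
    ContMDiffAt 𝓘(ℂ, EA) 𝓘(ℂ, EA →L[ℂ] EX) ω (diffCoord ι a₀) a₀ :=
  (ι.contMDiff.contMDiffAt).mfderiv_const (by simp)

theorem exists_transverse (hι : IsHypersurface ι) (a₀ : A) : ∃ v : EX, v ∉ (diffCoord ι a₀ a₀).range := by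
  by_contra! h
  have h1 : (diffCoord ι a₀ a₀).range = ⊤ := by ext; simp [h]
  have h2 := LinearMap.finrank_range_le (diffCoord ι a₀ a₀).toLinearMap
  have h3 : Module.finrank ℂ (diffCoord ι a₀ a₀).range = Module.finrank ℂ EX := by
    rw [h1]; exact finrank_top ℂ EX
  have := hι.codim
  change Module.finrank ℂ (diffCoord ι a₀ a₀).range ≤ _ at h2
  omega

/-- A vector transverse to `A` at `a₀`, in coordinates. -/
def transverse (a₀ : A) : EX := (hι.exists_transverse a₀).choose

/-- In coordinates at `a₀`, the map `T_aA × ℂ → T_aX` given by the differential of `ι` and the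
transverse vector. -/
def frameMap (a₀ a : A) : EA × ℂ →L[ℂ] EX :=
  (diffCoord ι a₀ a).coprod (ContinuousLinearMap.toSpanSingleton ℂ (hι.transverse a₀))

/-- The set over which the transverse vector at `a₀` trivializes the normal bundle. -/
def trivSet (a₀ : A) : Set A := interior {a |
  a ∈ (trivializationAt EA (TangentSpace 𝓘(ℂ, EA) : A → Type) a₀).baseSet ∧
  ι a ∈ (trivializationAt EX (TangentSpace 𝓘(ℂ, EX) : X → Type) (ι a₀)).baseSet ∧
  ContMDiffAt 𝓘(ℂ, EA) 𝓘(ℂ, EA →L[ℂ] EX) ω (diffCoord ι a₀) a ∧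
  (hι.frameMap a₀ a).IsInvertible}

/-- The linear form on `T_aX` whose kernel is `T_aA` and which is `1` on the transverse vector. -/
def conormal (a₀ a : A) : TangentSpace 𝓘(ℂ, EX) (ι a) →L[ℂ] ℂ :=
  ((ContinuousLinearMap.snd ℂ EA ℂ).comp (hι.frameMap a₀ a).inverse).comp
    ((trivializationAt EX (TangentSpace 𝓘(ℂ, EX)) (ι a₀)).continuousLinearMapAt ℂ (ι a))

theorem contMDiffOn_frameMap (a₀ : A) :
    ContMDiffOn 𝓘(ℂ, EA) 𝓘(ℂ, EA × ℂ →L[ℂ] EX) ω (hι.frameMap a₀) (hι.trivSet a₀) := by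
  intro a ha
  have h := (interior_subset ha).2.2.1
  have h2 : ContDiff ℂ ω (fun L : EA →L[ℂ] EX ↦
    L.coprod (ContinuousLinearMap.toSpanSingleton ℂ (hι.transverse a₀))) := by
    have : (fun L : EA →L[ℂ] EX ↦
      L.coprod (ContinuousLinearMap.toSpanSingleton ℂ (hι.transverse a₀))) = fun L ↦
      L.comp (ContinuousLinearMap.fst ℂ EA ℂ) +
        (ContinuousLinearMap.toSpanSingleton ℂ (hι.transverse a₀)).comp
          (ContinuousLinearMap.snd ℂ EA ℂ) := by ext <;> simp
    rw [this]
    exact (contDiff_id.clm_comp contDiff_const).add contDiff_const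
  exact (h2.contMDiff.contMDiffAt.comp a h).contMDiffWithinAt

theorem mem_trivSet (a₀ : A) : a₀ ∈ hι.trivSet a₀ := by
  rw [trivSet, mem_interior_iff_mem_nhds]
  have e1 := (trivializationAt EA (TangentSpace 𝓘(ℂ, EA) : A → Type) a₀).open_baseSet.mem_nhds
    (FiberBundle.mem_baseSet_trivializationAt' a₀)
  have e2 := ι.contMDiff.continuous.continuousAt.preimage_mem_nhds
    ((trivializationAt EX (TangentSpace 𝓘(ℂ, EX) : X → Type) (ι a₀)).open_baseSet.mem_nhds
    (FiberBundle.mem_baseSet_trivializationAt' (ι a₀)))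
  have e3 := (contMDiffAt_iff_contMDiffAt_nhds (by simp)).1 (contMDiffAt_diffCoord (ι := ι) a₀)
  have hinj : Function.Injective (diffCoord ι a₀ a₀) := by
    intro u u' h
    rw [diffCoord_apply, diffCoord_apply] at h
    have m1 := FiberBundle.mem_baseSet_trivializationAt' (F := EX)
      (E := (TangentSpace 𝓘(ℂ, EX) : X → Type)) (ι a₀)
    have m2 := FiberBundle.mem_baseSet_trivializationAt' (F := EA)
      (E := (TangentSpace 𝓘(ℂ, EA) : A → Type)) a₀
    have h1 := (Function.LeftInverse.injective
      (Trivialization.symmL_continuousLinearMapAt (R := ℂ) _ m1)) h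
    have h2 := hι.mfderiv_injective a₀ h1
    exact (Function.LeftInverse.injective
      (Trivialization.continuousLinearMapAt_symmL (R := ℂ) _ m2)) h2
  have hinj' : Function.Injective (hι.frameMap a₀ a₀) := by
    rw [injective_iff_map_eq_zero]
    rintro ⟨u, c⟩ h
    simp only [frameMap, ContinuousLinearMap.coprod_apply,
      ContinuousLinearMap.toSpanSingleton_apply] at h
    have hc : c = 0 := by
      by_contra hc
      apply (hι.exists_transverse a₀).choose_spec
      refine ⟨-(c⁻¹ • u), ?_⟩
      have : diffCoord ι a₀ a₀ u = - (c • hι.transverse a₀) := eq_neg_of_add_eq_zero_left h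
      change diffCoord ι a₀ a₀ (-(c⁻¹ • u)) = hι.transverse a₀
      rw [map_neg, map_smul, this, smul_neg, neg_neg, smul_smul, inv_mul_cancel₀ hc, one_smul]
    subst hc
    rw [zero_smul, add_zero] at h
    rw [hinj (h.trans (map_zero _).symm)]; rfl
  have hinv : (hι.frameMap a₀ a₀).IsInvertible := by
    let e := LinearEquiv.ofInjectiveOfFinrankEq (hι.frameMap a₀ a₀).toLinearMap hinj'
      (by rw [Module.finrank_prod, Module.finrank_self, hι.codim])
    exact ⟨e.toContinuousLinearEquiv, by ext <;> rfl⟩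
  have e4 : ∀ᶠ a in 𝓝 a₀, (hι.frameMap a₀ a).IsInvertible := by
    have hcont : ContinuousAt (hι.frameMap a₀) a₀ := by
      have h := (contMDiffAt_diffCoord (ι := ι) a₀).continuousAt
      have : hι.frameMap a₀ = fun a ↦
        (diffCoord ι a₀ a).comp (ContinuousLinearMap.fst ℂ EA ℂ) +
        (ContinuousLinearMap.toSpanSingleton ℂ (hι.transverse a₀)).comp
          (ContinuousLinearMap.snd ℂ EA ℂ) := by ext a <;> simp [frameMap]
      rw [this]
      exact (h.clm_comp continuousAt_const).add continuousAt_const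
    obtain ⟨e, he⟩ := hinv
    exact hcont (he ▸ e.nhds)
  filter_upwards [e1, e2, e3, e4] with a h1 h2 h3 h4 using ⟨h1, h2, h3, h4⟩

variable {hι} in
theorem conormal_eq_zero_iff {a₀ a : A} (ha : a ∈ hι.trivSet a₀)
    (w : TangentSpace 𝓘(ℂ, EX) (ι a)) :
    hι.conormal a₀ a w = 0 ↔ w ∈ (mfderiv 𝓘(ℂ, EA) 𝓘(ℂ, EX) ι a).range := by
  obtain ⟨h1, h2, -, h4⟩ := interior_subset ha
  let eA := (trivializationAt EA (TangentSpace 𝓘(ℂ, EA) : A → Type) a₀).continuousLinearEquivAt ℂ a h1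
  let eX := (trivializationAt EX (TangentSpace 𝓘(ℂ, EX) : X → Type)
    (ι a₀)).continuousLinearEquivAt ℂ (ι a) h2
  have hX : ∀ w, (trivializationAt EX (TangentSpace 𝓘(ℂ, EX) : X → Type)
    (ι a₀)).continuousLinearMapAt ℂ (ι a) w = eX w :=
    fun w ↦ (congrFun (Trivialization.coe_continuousLinearEquivAt_eq _ h2) w).symm
  have hA : ∀ u, (trivializationAt EA (TangentSpace 𝓘(ℂ, EA) : A → Type) a₀).symmL ℂ a u =
      eA.symm u :=
    fun u ↦ (congrFun (Trivialization.symm_continuousLinearEquivAt_eq _ h1) u).symm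
  have hd : ∀ u, diffCoord ι a₀ a u = eX (mfderiv 𝓘(ℂ, EA) 𝓘(ℂ, EX) ι a (eA.symm u)) := by
    intro u
    rw [diffCoord_apply, hA]
    exact hX _
  have hf : ∀ p, hι.frameMap a₀ a p = diffCoord ι a₀ a p.1 + p.2 • hι.transverse a₀ := by
    intro p; simp [frameMap]
  have hc : hι.conormal a₀ a w = ((hι.frameMap a₀ a).inverse (eX w)).2 := by
    rw [← hX]; rfl
  rw [hc]
  constructor
  · intro h
    have := h4.self_apply_inverse (eX w)
    rw [hf, h, zero_smul, add_zero, hd] at this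
    exact ⟨_, eX.injective this⟩
  · rintro ⟨u, rfl⟩
    have : eX (mfderiv 𝓘(ℂ, EA) 𝓘(ℂ, EX) ι a u) = hι.frameMap a₀ a (eA u, 0) := by
      rw [hf, hd]; simp
    erw [this, h4.inverse_apply_self]

/-- The linear form on `N_a` induced by `conormal` (it is set to `0` if `conormal` does not
descend, which does not happen on `trivSet`). -/
def toLine (a₀ a : A) : hι.Normal a →ₗ[ℂ] ℂ :=
  open Classical in
  if h : (mfderiv 𝓘(ℂ, EA) 𝓘(ℂ, EX) ι a).range ≤ (hι.conormal a₀ a).ker then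
    { toFun := Submodule.liftQ _ (hι.conormal a₀ a).toLinearMap h
      map_add' := map_add (Submodule.liftQ _ (hι.conormal a₀ a).toLinearMap h)
      map_smul' := map_smul (Submodule.liftQ _ (hι.conormal a₀ a).toLinearMap h) } else 0

/-- The class in `N_a` of the multiple by `z` of the transverse vector at `a₀`. -/
def ofLine (a₀ a : A) : ℂ →ₗ[ℂ] hι.Normal a :=
  LinearMap.toSpanSingleton ℂ _ (hι.toNormal a
    ((trivializationAt EX (TangentSpace 𝓘(ℂ, EX) : X → Type) (ι a₀)).symmL ℂ (ι a)
      (hι.transverse a₀)))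

variable {hι} in
theorem toLine_toNormal {a₀ a : A} (ha : a ∈ hι.trivSet a₀) (w : TangentSpace 𝓘(ℂ, EX) (ι a)) :
    hι.toLine a₀ a (hι.toNormal a w) = hι.conormal a₀ a w := by
  have h : (mfderiv 𝓘(ℂ, EA) 𝓘(ℂ, EX) ι a).range ≤ (hι.conormal a₀ a).ker :=
    fun w hw ↦ (conormal_eq_zero_iff ha w).2 hw
  rw [toLine, dif_pos h]
  rfl

variable {hι} in
theorem toLine_ofLine {a₀ a : A} (ha : a ∈ hι.trivSet a₀) (z : ℂ) :
    hι.toLine a₀ a (hι.ofLine a₀ a z) = z := by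
  obtain ⟨h1, h2, -, h4⟩ := interior_subset ha
  rw [ofLine, LinearMap.toSpanSingleton_apply, map_smul, toLine_toNormal ha]
  have : hι.transverse a₀ = hι.frameMap a₀ a (0, 1) := by simp [frameMap]
  have h5 : hι.conormal a₀ a ((trivializationAt EX (TangentSpace 𝓘(ℂ, EX) : X → Type)
      (ι a₀)).symmL ℂ (ι a) (hι.transverse a₀)) = 1 := by
    rw [conormal, ContinuousLinearMap.comp_apply,
      Trivialization.continuousLinearMapAt_symmL _ h2, this]
    erw [ContinuousLinearMap.comp_apply, h4.inverse_apply_self]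
    rfl
  rw [h5]; simp

variable {hι} in
theorem toLine_injective {a₀ a : A} (ha : a ∈ hι.trivSet a₀) :
    Function.Injective (hι.toLine a₀ a) := by
  rw [injective_iff_map_eq_zero]
  intro x hx
  obtain ⟨w, rfl⟩ := Submodule.mkQ_surjective _ x
  change hι.toLine a₀ a (hι.toNormal a w) = 0 at hx
  rw [toLine_toNormal ha, conormal_eq_zero_iff ha] at hx
  exact (Submodule.Quotient.mk_eq_zero _).2 hx

variable {hι} in
theorem ofLine_toLine {a₀ a : A} (ha : a ∈ hι.trivSet a₀) (x : hι.Normal a) :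
    hι.ofLine a₀ a (hι.toLine a₀ a x) = x :=
  toLine_injective ha (toLine_ofLine ha _)

/-- The local trivialization of the normal bundle given by the transverse vector at `a₀`. -/
def pretriv (a₀ : A) : Pretrivialization ℂ (π ℂ hι.Normal) where
  toFun p := (p.1, hι.toLine a₀ p.1 p.2)
  invFun q := ⟨q.1, hι.ofLine a₀ q.1 q.2⟩
  source := π ℂ hι.Normal ⁻¹' hι.trivSet a₀
  target := hι.trivSet a₀ ×ˢ Set.univ
  map_source' p hp := ⟨hp, trivial⟩
  map_target' q hq := hq.1
  left_inv' := by
    rintro ⟨a, x⟩ ha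
    exact congrArg (TotalSpace.mk a) (ofLine_toLine ha x)
  right_inv' := by
    rintro ⟨a, z⟩ ⟨ha, -⟩
    exact Prod.ext rfl (toLine_ofLine ha z)
  open_target := isOpen_interior.prod isOpen_univ
  baseSet := hι.trivSet a₀
  open_baseSet := isOpen_interior
  source_eq := rfl
  target_eq := rfl
  proj_toFun _ _ := rfl

theorem pretriv_apply (a₀ a : A) (x : hι.Normal a) :
    hι.pretriv a₀ ⟨a, x⟩ = (a, hι.toLine a₀ a x) := rfl

variable {hι} in
theorem pretriv_symm {a₀ a : A} (ha : a ∈ hι.trivSet a₀) (z : ℂ) :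
    (hι.pretriv a₀).symm a z = hι.ofLine a₀ a z := by
  rw [Pretrivialization.symm_apply _ ha]
  rfl

/-- The transition functions of the normal bundle. -/
def transition (a₀ a₁ a : A) : ℂ →L[ℂ] ℂ :=
  ((ContinuousLinearMap.snd ℂ EA ℂ).comp (hι.frameMap a₁ a).inverse).comp <|
    ((trivializationAt EX (TangentSpace 𝓘(ℂ, EX) : X → Type) (ι a₀)).coordChangeL ℂ
      (trivializationAt EX (TangentSpace 𝓘(ℂ, EX) : X → Type) (ι a₁)) (ι a) : EX →L[ℂ] EX).comp
    (ContinuousLinearMap.toSpanSingleton ℂ (hι.transverse a₀))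

variable {hι} in
theorem transition_apply {a₀ a₁ a : A} (ha : a ∈ hι.trivSet a₀ ∩ hι.trivSet a₁) (z : ℂ) :
    hι.transition a₀ a₁ a z = (hι.pretriv a₁ ⟨a, (hι.pretriv a₀).symm a z⟩).2 := by
  rw [pretriv_symm ha.1, pretriv_apply, ofLine, LinearMap.toSpanSingleton_apply, map_smul,
    toLine_toNormal ha.2]
  have h0 := (interior_subset ha.1).2.1
  have h1 := (interior_subset ha.2).2.1
  have : hι.transition a₀ a₁ a z = z • hι.transition a₀ a₁ a 1 := by
    rw [← map_smul]; simp
  rw [this]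
  congr 1
  simp only [transition, conormal, ContinuousLinearMap.comp_apply,
    ContinuousLinearMap.toSpanSingleton_apply, one_smul]
  congr 2
  erw [Trivialization.coordChangeL_apply _ _ ⟨h0, h1⟩]
  rw [Trivialization.continuousLinearMapAt_apply, Trivialization.coe_linearMapAt_of_mem _ h1,
    Trivialization.symmL_apply _ h0]

theorem contMDiffOn_transition (a₀ a₁ : A) :
    ContMDiffOn 𝓘(ℂ, EA) 𝓘(ℂ, ℂ →L[ℂ] ℂ) ω (hι.transition a₀ a₁)
      (hι.trivSet a₀ ∩ hι.trivSet a₁) := by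
  have h1 := (contMDiffOn_coordChangeL (n := ω) (IB := 𝓘(ℂ, EX))
      (trivializationAt EX (TangentSpace 𝓘(ℂ, EX) : X → Type) (ι a₀))
      (trivializationAt EX (TangentSpace 𝓘(ℂ, EX) : X → Type) (ι a₁))).comp
    (ι.contMDiff.contMDiffOn (s := hι.trivSet a₀ ∩ hι.trivSet a₁))
    (fun a ha ↦ ⟨(interior_subset ha.1).2.1, (interior_subset ha.2).2.1⟩)
  have h2 : ContMDiffOn 𝓘(ℂ, EA) 𝓘(ℂ, EX →L[ℂ] EA × ℂ) ω
      (fun a ↦ (hι.frameMap a₁ a).inverse) (hι.trivSet a₀ ∩ hι.trivSet a₁) := by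
    intro a ha
    have h3 := (interior_subset ha.2).2.2.2.contDiffAt_map_inverse (n := ω)
    exact h3.contMDiffAt.comp_contMDiffWithinAt a
      ((hι.contMDiffOn_frameMap a₁ a ha.2).mono Set.inter_subset_right)
  exact (contMDiffOn_const.clm_comp h2).clm_comp (h1.clm_comp contMDiffOn_const)

/-- The holomorphic line bundle structure of the normal bundle: locally, the class of a constant
vector (in a chart of `X`) transverse to `A` is a holomorphic frame. -/
def prebundle : VectorPrebundle ℂ ℂ hι.Normal where
  pretrivializationAtlas := Set.range hι.pretriv
  pretrivialization_linear' := by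
    rintro _ ⟨a₀, rfl⟩
    exact ⟨fun a _ ↦ (hι.toLine a₀ a).isLinear⟩
  pretrivializationAt := hι.pretriv
  mem_base_pretrivializationAt := hι.mem_trivSet
  pretrivialization_mem_atlas a₀ := ⟨a₀, rfl⟩
  exists_coordChange := by
    rintro _ ⟨a₀, rfl⟩ _ ⟨a₁, rfl⟩
    exact ⟨hι.transition a₀ a₁, (hι.contMDiffOn_transition a₀ a₁).continuousOn,
      fun a ha z ↦ transition_apply ha z⟩
  totalSpaceMk_isInducing a := by
    have ha := hι.mem_trivSet a
    let e : hι.Normal a ≃ₗ[ℂ] ℂ := LinearEquiv.ofBijective (hι.toLine a a)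
      ⟨toLine_injective ha, fun z ↦ ⟨_, toLine_ofLine ha z⟩⟩
    have : FiniteDimensional ℂ (hι.Normal a) := e.symm.finiteDimensional
    exact Topology.isInducing_const_prod.2 e.toContinuousLinearEquiv.toHomeomorph.isInducing

instance : hι.prebundle.IsContMDiff 𝓘(ℂ, EA) ω where
  exists_contMDiffCoordChange := by
    rintro _ ⟨a₀, rfl⟩ _ ⟨a₁, rfl⟩
    exact ⟨hι.transition a₀ a₁, hι.contMDiffOn_transition a₀ a₁, fun a ha z ↦ transition_apply ha z⟩

instance : TopologicalSpace (TotalSpace ℂ hι.Normal) := hι.prebundle.totalSpaceTopology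
instance : FiberBundle ℂ hι.Normal := hι.prebundle.toFiberBundle
instance : VectorBundle ℂ ℂ hι.Normal := hι.prebundle.toVectorBundle
instance : ContMDiffVectorBundle ω ℂ hι.Normal 𝓘(ℂ, EA) :=
  hι.prebundle.contMDiffVectorBundle 𝓘(ℂ, EA)

end IsHypersurface
end

section
variable (EA : Type) [NormedAddCommGroup EA] [NormedSpace ℂ EA]
  {A : Type u} [TopologicalSpace A] [ChartedSpace EA A]

/-- The section `s` of the bundle `V` is holomorphic on `O`. -/
def IsHolomorphicSectionOn (F : Type) [NormedAddCommGroup F] [NormedSpace ℂ F] (V : A → Type)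
    [TopologicalSpace (TotalSpace F V)] [∀ a, TopologicalSpace (V a)] [FiberBundle F V]
    (s : ∀ a, V a) (O : Set A) : Prop :=
  ContMDiffOn 𝓘(ℂ, EA) (𝓘(ℂ, EA).prod 𝓘(ℂ, F)) ω (fun a ↦ TotalSpace.mk' F a (s a)) O

variable (F₁ : Type) [NormedAddCommGroup F₁] [NormedSpace ℂ F₁] (V : A → Type)
  [TopologicalSpace (TotalSpace F₁ V)] [∀ a, TopologicalSpace (V a)] [FiberBundle F₁ V]
  [∀ a, AddCommGroup (V a)] [∀ a, Module ℂ (V a)]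
  (F₂ : Type) [NormedAddCommGroup F₂] [NormedSpace ℂ F₂] (W : A → Type)
  [TopologicalSpace (TotalSpace F₂ W)] [∀ a, TopologicalSpace (W a)] [FiberBundle F₂ W]
  [∀ a, AddCommGroup (W a)] [∀ a, Module ℂ (W a)]

/-- A section `t` of `V ⊗ W` over the open set `U` is holomorphic if locally it is a finite sum
of tensors `v ⊗ w` of holomorphic sections `v` of `V` and `w` of `W`. -/
def IsHolomorphicTensor (U : Opens A) (t : ∀ a : U, V a ⊗[ℂ] W a) : Prop :=
  ∀ a : U, ∃ O : Opens A, (a : A) ∈ O ∧ ∃ (k : ℕ) (v : Fin k → ∀ b, V b) (w : Fin k → ∀ b, W b),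
    (∀ i, IsHolomorphicSectionOn EA F₁ V (v i) O) ∧
    (∀ i, IsHolomorphicSectionOn EA F₂ W (w i) O) ∧
    ∀ b : U, (b : A) ∈ O → t b = ∑ i, v i b ⊗ₜ[ℂ] w i b

/-- The group of holomorphic sections of `V ⊗ W` over the open set `U`. -/
def tensorSections [VectorBundle ℂ F₁ V] [ContMDiffVectorBundle ω F₁ V 𝓘(ℂ, EA)] (U : Opens A) :
    AddSubgroup (∀ a : U, V a ⊗[ℂ] W a) where
  carrier := {t | IsHolomorphicTensor EA F₁ V F₂ W U t}
  zero_mem' a := ⟨⊤, trivial, 0, Fin.elim0, Fin.elim0, fun i ↦ i.elim0, fun i ↦ i.elim0, by simp⟩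
  add_mem' := by
    intro t t' ht ht' a
    obtain ⟨O, hO, k, v, w, hv, hw, h⟩ := ht a
    obtain ⟨O', hO', k', v', w', hv', hw', h'⟩ := ht' a
    refine ⟨O ⊓ O', ⟨hO, hO'⟩, k + k', Fin.append v v', Fin.append w w', ?_, ?_, ?_⟩
    · refine Fin.addCases (fun i ↦ ?_) (fun i ↦ ?_)
      · rw [Fin.append_left]; exact (hv i).mono Set.inter_subset_left
      · rw [Fin.append_right]; exact (hv' i).mono Set.inter_subset_right
    · refine Fin.addCases (fun i ↦ ?_) (fun i ↦ ?_)
      · rw [Fin.append_left]; exact (hw i).mono Set.inter_subset_left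
      · rw [Fin.append_right]; exact (hw' i).mono Set.inter_subset_right
    · intro b hb
      simp [Fin.sum_univ_add, h b hb.1, h' b hb.2]
  neg_mem' := by
    intro t ht a
    obtain ⟨O, hO, k, v, w, hv, hw, h⟩ := ht a
    refine ⟨O, hO, k, fun i ↦ -v i, w, fun i ↦ ContMDiffOn.neg_section (hv i), hw, fun b hb ↦ ?_⟩
    simp [h b hb, TensorProduct.neg_tmul]

/-- Restriction of holomorphic sections of `V ⊗ W`. -/
def tensorRes [VectorBundle ℂ F₁ V] [ContMDiffVectorBundle ω F₁ V 𝓘(ℂ, EA)] {U U' : Opens A}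
    (i : U ≤ U') : tensorSections EA F₁ V F₂ W U' →+ tensorSections EA F₁ V F₂ W U where
  toFun t := ⟨fun a ↦ t.1 ⟨a, i a.2⟩, fun a ↦ by
    obtain ⟨O, hO, k, v, w, hv, hw, h⟩ := t.2 ⟨a, i a.2⟩
    exact ⟨O, hO, k, v, w, hv, hw, fun b hb ↦ h ⟨b, i b.2⟩ hb⟩⟩
  map_zero' := rfl
  map_add' _ _ := rfl

/-- Being a holomorphic section of `V ⊗ W` is a local condition. -/
def tensorLocalPredicate [VectorBundle ℂ F₁ V] [ContMDiffVectorBundle ω F₁ V 𝓘(ℂ, EA)] :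
    TopCat.LocalPredicate (X := TopCat.of A) (fun a : A ↦ V a ⊗[ℂ] W a) where
  pred {U} t := t ∈ tensorSections EA F₁ V F₂ W U
  res i t ht := (tensorRes EA F₁ V F₂ W i.le ⟨t, ht⟩).2
  locality {U} t ht a := by
    obtain ⟨U', ha, i, h⟩ := ht a
    obtain ⟨O, hO, k, v, w, hv, hw, h⟩ := h ⟨a, ha⟩
    exact ⟨O ⊓ U', ⟨hO, ha⟩, k, v, w, fun i ↦ (hv i).mono Set.inter_subset_left,
      fun i ↦ (hw i).mono Set.inter_subset_left, fun b hb ↦ h ⟨b, hb.2⟩ hb.1⟩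

/-- The sheaf of holomorphic sections of `V ⊗ W`, as a sheaf of abelian groups. -/
def tensorSheaf [VectorBundle ℂ F₁ V] [ContMDiffVectorBundle ω F₁ V 𝓘(ℂ, EA)]
    [VectorBundle ℂ F₂ W] [ContMDiffVectorBundle ω F₂ W 𝓘(ℂ, EA)] :
    TopCat.Sheaf AddCommGrpCat.{u} (TopCat.of A) where
  obj :=
    { obj := fun U ↦ AddCommGrpCat.of (tensorSections EA F₁ V F₂ W U.unop)
      map := fun i ↦ AddCommGrpCat.ofHom (tensorRes EA F₁ V F₂ W i.unop.le)
      map_id := fun _ ↦ rfl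
      map_comp := fun _ _ ↦ rfl }
  property := by
    rw [CategoryTheory.Presheaf.isSheaf_iff_isSheaf_forget _ _ (CategoryTheory.forget AddCommGrpCat)]
    exact TopCat.subpresheafToTypes.isSheaf (tensorLocalPredicate EA F₁ V F₂ W)

end

section
variable (EA : Type) [NormedAddCommGroup EA] [NormedSpace ℂ EA]
  {A : Type u} [TopologicalSpace A] [ChartedSpace EA A]
  (F₁ : Type) [NormedAddCommGroup F₁] [NormedSpace ℂ F₁] (V : A → Type)
  [TopologicalSpace (TotalSpace F₁ V)] [∀ a, TopologicalSpace (V a)] [FiberBundle F₁ V]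
  [∀ a, AddCommMonoid (V a)] [∀ a, Module ℂ (V a)]
  (F₂ : Type) [NormedAddCommGroup F₂] [NormedSpace ℂ F₂] (W : A → Type)
  [TopologicalSpace (TotalSpace F₂ W)] [∀ a, TopologicalSpace (W a)] [FiberBundle F₂ W]
  [∀ a, AddCommMonoid (W a)] [∀ a, Module ℂ (W a)]

/-- An isomorphism of holomorphic vector bundles `V` and `W` over `A`: a family of linear
isomorphisms of the fibres which is holomorphic in both directions on the total spaces. -/
structure HolomorphicBundleIso where
  fiber : ∀ a, V a ≃L[ℂ] W a
  holomorphic : ContMDiff (𝓘(ℂ, EA).prod 𝓘(ℂ, F₁)) (𝓘(ℂ, EA).prod 𝓘(ℂ, F₂)) ω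
    (fun p : TotalSpace F₁ V ↦ TotalSpace.mk' F₂ p.1 (fiber p.1 p.2))
  holomorphic_symm : ContMDiff (𝓘(ℂ, EA).prod 𝓘(ℂ, F₂)) (𝓘(ℂ, EA).prod 𝓘(ℂ, F₁)) ω
    (fun p : TotalSpace F₂ W ↦ TotalSpace.mk' F₁ p.1 ((fiber p.1).symm p.2))

end

section
variable {EX EA : Type} [NormedAddCommGroup EX] [NormedSpace ℂ EX] [FiniteDimensional ℂ EX]
  [NormedAddCommGroup EA] [NormedSpace ℂ EA] [FiniteDimensional ℂ EA]
  {X : Type v} [TopologicalSpace X] [ChartedSpace EX X] [IsManifold 𝓘(ℂ, EX) ω X]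
  {A : Type u} [TopologicalSpace A] [ChartedSpace EA A] [IsManifold 𝓘(ℂ, EA) ω A]
  {ι : ContMDiffMap 𝓘(ℂ, EA) 𝓘(ℂ, EX) A X ω} (hι : IsHypersurface ι)

/-- The fibres of the dual `N⁻¹` of the normal bundle; its holomorphic structure is that of the
bundle of homomorphisms from `N` to the trivial line bundle. -/
abbrev IsHypersurface.DualNormal (a : A) : Type := hι.Normal a →L[ℂ] Bundle.Trivial A ℂ a

/-- The fibres of the restriction `TX|_A`, with the structure of the pullback bundle. -/
abbrev IsHypersurface.TangentRestrict (_ : IsHypersurface ι) : A → Type :=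
  ι *ᵖ (TangentSpace 𝓘(ℂ, EX) : X → Type)

/-- The sheaf of holomorphic sections of `N⁻¹ ⊗ TA`. -/
def IsHypersurface.dualNormalTensorTangent : TopCat.Sheaf AddCommGrpCat.{u} (TopCat.of A) :=
  tensorSheaf EA (ℂ →L[ℂ] ℂ) hι.DualNormal EA (TangentSpace 𝓘(ℂ, EA) : A → Type)
end

end

/-!
The inclusion `TA → TX|_A` splits as soon as it has a holomorphic retraction `R : TX|_A → TA`, since
`w ↦ (q w, R w)`, with `q : TX|_A → N` the quotient map, is then the required isomorphism.

Retractions exist locally: over `hι.trivSet a₀` a chart gives a frame of `TX|_A` consisting of `TA`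
and a transverse field `v₀`, and `hι.localRetraction a₀` is the projection `ρ₀` to `TA` along `v₀`.
Two retractions differ by a map that vanishes on `TA`, i.e. by the contraction of a section of
`N⁻¹ ⊗ TA` with `q`. Hence the local retractions form a torsor under the sheaf of holomorphic
sections of `N⁻¹ ⊗ TA`, whose class in `H¹(A, N⁻¹ ⊗ TA) = 0` is the obstruction to a global one.

To use the vanishing of the derived-functor `H¹`, the sheaf `F` of holomorphic sections is embedded
into the sheaf `D` of all set-theoretic sections. Sections `s_i` of `D` over a cover with all
`s_i - s_j` in `F` define a global section of `D / F`, which lifts to a global section `d` of `D` by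
the long exact cohomology sequence; then every `d - s_i` lies in `F`
(`exists_global_of_compatible_mod`, `exists_global_tensor`). This is applied to the tensors
`s₀ = hι.splitTensor a₀` that describe the difference between `ρ₀` and the discontinuous retraction
`r_a = hι.localRetraction a a`. The corrected retraction `R = r - d ∘ q` equals `ρ₀ - (d - s₀) ∘ q`
near `a₀`, so it is holomorphic (`exists_retraction`). In the frame at `a₀`, the isomorphism and its
inverse are given by explicit holomorphic formulas in terms of the coordinates of `R v₀`
(`trivializationAt_prod_splittingEquiv`, `trivializationAt_tangentRestrict_splittingEquiv_symm`).
-/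

noncomputable section

/-! ### Vanishing of the first cohomology and lifting of sections -/

section SheafCohomology

open Opposite

/-- For a short exact sequence of abelian sheaves whose kernel has vanishing `H¹`, global sections of
the quotient lift: this is the long exact cohomology sequence in degrees `0` and `1`. -/
theorem exists_section_of_subsingleton_H_one {C : Type*} [Category C]
    {J : GrothendieckTopology C} [HasSheafify J AddCommGrpCat.{u}]
    [HasExt (Sheaf J AddCommGrpCat.{u})] {T : C} (hT : Limits.IsTerminal T)
    {S : ShortComplex (Sheaf J AddCommGrpCat.{u})} (hS : S.ShortExact)
    (h : Subsingleton (Sheaf.H S.X₁ 1)) (s : S.X₃.obj.obj (op T)) :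
    ∃ t : S.X₂.obj.obj (op T), S.g.hom.app (op T) t = s := by
  obtain ⟨x, hx⟩ := Abelian.Ext.covariant_sequence_exact₃ _ hS ((Sheaf.H.equiv₀ S.X₃ hT).symm s)
    (zero_add 1) (@Subsingleton.elim _ h _ _)
  refine ⟨Sheaf.H.equiv₀ S.X₂ hT x, ?_⟩
  rw [Sheaf.H.equiv₀_naturality, Sheaf.H.map_apply, hx, AddEquiv.apply_symm_apply]

variable {Y : TopCat.{u}}

/-- Let `F` be a subsheaf of `D` with `H¹(F) = 0`. Local sections of `D` that agree modulo `F` on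
overlaps come, modulo `F`, from a global section of `D`: they glue to a section of `D / F`, which
lifts. -/
theorem exists_global_of_compatible_mod
    {F D : TopCat.Sheaf AddCommGrpCat.{u} Y} (f : F ⟶ D) [Mono f]
    (h : Subsingleton (Sheaf.H F 1)) {I : Type*} (U : I → Opens Y) (hU : ⊤ ≤ iSup U)
    (s : ∀ i, D.obj.obj (op (U i)))
    (hs : ∀ i j, ∃ t : F.obj.obj (op (U i ⊓ U j)), f.hom.app _ t =
      D.obj.map (Opens.infLELeft (U i) (U j)).op (s i) -
        D.obj.map (Opens.infLERight (U i) (U j)).op (s j)) :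
    ∃ d : D.obj.obj (op ⊤), ∀ i, ∃ t : F.obj.obj (op (U i)),
      f.hom.app _ t = D.obj.map (homOfLE (le_top : U i ≤ ⊤)).op d - s i := by
  let S : ShortComplex (TopCat.Sheaf AddCommGrpCat.{u} Y) :=
    ShortComplex.mk f (Limits.cokernel.π f) (Limits.cokernel.condition f)
  have hS : S.ShortExact := { exact := ShortComplex.exact_cokernel f }
  have hz (V : Opens Y) (t : F.obj.obj (op V)) : S.g.hom.app (op V) (f.hom.app (op V) t) = 0 := by
    have := congrArg (fun k ↦ k.hom.app (op V) t) S.zero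
    exact this
  have hn {V W : Opens Y} (k : V ⟶ W) (x : D.obj.obj (op W)) :
      S.g.hom.app (op V) (D.obj.map k.op x) = S.X₃.obj.map k.op (S.g.hom.app (op W) x) :=
    NatTrans.naturality_apply S.g.hom k.op x
  -- The images of the `s i` in the quotient sheaf agree on overlaps, so they glue.
  obtain ⟨q, hq, -⟩ := TopCat.Sheaf.existsUnique_gluing' S.X₃ U ⊤ (fun i ↦ homOfLE le_top) hU
    (fun i ↦ S.g.hom.app (op (U i)) (s i)) (by
      intro i j
      obtain ⟨t, ht⟩ := hs i j
      have := hz _ t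
      rw [ht, map_sub, sub_eq_zero] at this
      exact ((hn _ _).symm.trans this).trans (hn _ _))
  obtain ⟨d, hd⟩ := exists_section_of_subsingleton_H_one
    (C := Opens Y) Limits.isTerminalTop hS h q
  refine ⟨d, fun i ↦ ?_⟩
  obtain ⟨t, ht⟩ := TopCat.Sheaf.sections_exact_of_left_exact hS.1 hS.2
    (D.obj.map (homOfLE (le_top : U i ≤ ⊤)).op d - s i) (by
      rw [map_sub, sub_eq_zero]
      exact (hn _ _).trans ((congrArg _ hd).trans (hq i)))
  exact ⟨t, ht⟩

end SheafCohomology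

/-! ### Tensors that are holomorphic up to a coboundary -/

section TensorSections

open Opposite

/-- The sheaf of all (not necessarily continuous) sections of a family of abelian groups over a
topological space. -/
def discontinuousSections {A : Type u} [TopologicalSpace A] (M : A → Type)
    [∀ a, AddCommGroup (M a)] : TopCat.Sheaf AddCommGrpCat.{u} (TopCat.of A) where
  obj :=
    { obj := fun U ↦ AddCommGrpCat.of (∀ a : U.unop, M a)
      map := fun {U V} i ↦ AddCommGrpCat.ofHom
        { toFun := fun t (a : V.unop) ↦ t ⟨a, i.unop.le a.2⟩
          map_zero' := rfl
          map_add' := fun _ _ ↦ rfl }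
      map_id := fun _ ↦ rfl
      map_comp := fun _ _ ↦ rfl }
  property := by
    rw [CategoryTheory.Presheaf.isSheaf_iff_isSheaf_forget _ _ (CategoryTheory.forget AddCommGrpCat)]
    exact TopCat.Presheaf.toTypes_isSheaf (TopCat.of A) M

variable (EA : Type) [NormedAddCommGroup EA] [NormedSpace ℂ EA]
  {A : Type u} [TopologicalSpace A] [ChartedSpace EA A]
  (F₁ : Type) [NormedAddCommGroup F₁] [NormedSpace ℂ F₁] (V : A → Type)
  [TopologicalSpace (TotalSpace F₁ V)] [∀ a, TopologicalSpace (V a)] [FiberBundle F₁ V]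
  [∀ a, AddCommGroup (V a)] [∀ a, Module ℂ (V a)]
  [VectorBundle ℂ F₁ V] [ContMDiffVectorBundle ω F₁ V 𝓘(ℂ, EA)]
  (F₂ : Type) [NormedAddCommGroup F₂] [NormedSpace ℂ F₂] (W : A → Type)
  [TopologicalSpace (TotalSpace F₂ W)] [∀ a, TopologicalSpace (W a)] [FiberBundle F₂ W]
  [∀ a, AddCommGroup (W a)] [∀ a, Module ℂ (W a)]
  [VectorBundle ℂ F₂ W] [ContMDiffVectorBundle ω F₂ W 𝓘(ℂ, EA)]

/-- The inclusion of the sheaf of holomorphic sections of `V ⊗ W` into the sheaf of all sections. -/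
def tensorSheafInclusion :
    tensorSheaf EA F₁ V F₂ W ⟶ discontinuousSections (fun a : A ↦ V a ⊗[ℂ] W a) :=
  ⟨{ app := fun U ↦ AddCommGrpCat.ofHom (tensorSections EA F₁ V F₂ W U.unop).subtype
     naturality := fun _ _ _ ↦ rfl }⟩

instance : Mono (tensorSheafInclusion EA F₁ V F₂ W) := by
  have (U : (Opens A)ᵒᵖ) : Mono ((tensorSheafInclusion EA F₁ V F₂ W).hom.app U) :=
    (AddCommGrpCat.mono_iff_injective _).2 Subtype.val_injective
  have := @NatTrans.mono_of_mono_app _ _ _ _ _ _ (tensorSheafInclusion EA F₁ V F₂ W).hom this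
  exact Sheaf.Hom.mono_of_presheaf_mono _ _ _

variable {EA F₁ V F₂ W}

/-- If `H¹` of the sheaf of holomorphic sections of `V ⊗ W` vanishes, then a family of set-theoretic
sections of `V ⊗ W` with holomorphic differences on the overlaps of an open cover becomes
holomorphic after subtraction from one global set-theoretic section. -/
theorem exists_global_tensor
    (h : Subsingleton (Sheaf.H (tensorSheaf EA F₁ V F₂ W) 1)) {I : Type*} (U : I → Opens A)
    (hU : ∀ a, ∃ i, a ∈ U i) (s : I → ∀ a, V a ⊗[ℂ] W a)
    (hs : ∀ i j, IsHolomorphicTensor EA F₁ V F₂ W (U i ⊓ U j) (fun a ↦ s i a - s j a)) :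
    ∃ d : ∀ a, V a ⊗[ℂ] W a, ∀ i,
      IsHolomorphicTensor EA F₁ V F₂ W (U i) (fun a ↦ d a - s i a) := by
  obtain ⟨d, hd⟩ := exists_global_of_compatible_mod (tensorSheafInclusion EA F₁ V F₂ W) h U
    (fun a _ ↦ Opens.mem_iSup.2 (hU a)) (fun i ↦ (fun a : U i ↦ s i a))
    (fun i j ↦ ⟨⟨_, hs i j⟩, rfl⟩)
  refine ⟨fun a ↦ d ⟨a, trivial⟩, fun i ↦ ?_⟩
  obtain ⟨t, ht⟩ := hd i
  have : t.1 = fun a : U i ↦ d ⟨a, trivial⟩ - s i a := ht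
  rw [← this]
  exact t.2

end TensorSections

/-! ### The local splittings of the tangent sequence -/

section Splitting

variable {EX EA : Type} [NormedAddCommGroup EX] [NormedSpace ℂ EX] [FiniteDimensional ℂ EX]
  [NormedAddCommGroup EA] [NormedSpace ℂ EA] [FiniteDimensional ℂ EA]
  {X : Type v} [TopologicalSpace X] [ChartedSpace EX X] [IsManifold 𝓘(ℂ, EX) ω X]
  {A : Type u} [TopologicalSpace A] [ChartedSpace EA A] [IsManifold 𝓘(ℂ, EA) ω A]
  {ι : ContMDiffMap 𝓘(ℂ, EA) 𝓘(ℂ, EX) A X ω} (hι : IsHypersurface ι)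

namespace IsHypersurface

/-- The coordinates of a tangent vector of `A` at `a` in the chart at `a₀`. -/
def coordA (a₀ a : A) : TangentSpace 𝓘(ℂ, EA) a →L[ℂ] EA :=
  (trivializationAt EA (TangentSpace 𝓘(ℂ, EA) : A → Type) a₀).continuousLinearMapAt ℂ a

/-- The coordinates of a tangent vector of `X` at `ι a` in the chart at `ι a₀`. -/
def coordX (ι : ContMDiffMap 𝓘(ℂ, EA) 𝓘(ℂ, EX) A X ω) (a₀ a : A) :
    TangentSpace 𝓘(ℂ, EX) (ι a) →L[ℂ] EX :=
  (trivializationAt EX (TangentSpace 𝓘(ℂ, EX) : X → Type) (ι a₀)).continuousLinearMapAt ℂ (ι a)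

/-- The vector field along `A`, defined near `a₀`, that is constantly equal to the transverse vector
in the chart at `ι a₀`. -/
def transverseField (a₀ a : A) : TangentSpace 𝓘(ℂ, EX) (ι a) :=
  (trivializationAt EX (TangentSpace 𝓘(ℂ, EX) : X → Type) (ι a₀)).symmL ℂ (ι a)
    (hι.transverse a₀)

/-- The projection `T_aX → T_aA` along the transverse field at `a₀`. It is a retraction of the
differential of `ι` for `a` in `trivSet a₀`, and a junk value elsewhere. -/
def localRetraction (a₀ a : A) : TangentSpace 𝓘(ℂ, EX) (ι a) →L[ℂ] TangentSpace 𝓘(ℂ, EA) a :=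
  (((trivializationAt EA (TangentSpace 𝓘(ℂ, EA) : A → Type) a₀).symmL ℂ a).comp
    ((ContinuousLinearMap.fst ℂ EA ℂ).comp (hι.frameMap a₀ a).inverse)).comp (coordX ι a₀ a)

/-- The linear form on `N_a` dual to the class of the transverse field at `a₀`, as a continuous
linear map; it agrees with `toLine` on `trivSet a₀` and is `0` elsewhere. -/
def lineCoord (a₀ a : A) : hι.Normal a →L[ℂ] ℂ :=
  (trivializationAt ℂ hι.Normal a₀).continuousLinearMapAt ℂ a

variable {hι}

theorem trivializationAt_normal_apply (a₀ a : A) (x : hι.Normal a) :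
    trivializationAt ℂ hι.Normal a₀ ⟨a, x⟩ = (a, hι.toLine a₀ a x) := rfl

variable {a₀ a : A}

theorem lineCoord_apply (ha : a ∈ hι.trivSet a₀) (x : hι.Normal a) :
    hι.lineCoord a₀ a x = hι.toLine a₀ a x := by
  rw [lineCoord, Trivialization.continuousLinearMapAt_apply,
    Trivialization.coe_linearMapAt_of_mem _ (by exact ha)]
  rfl

theorem lineCoord_toNormal (ha : a ∈ hι.trivSet a₀) (w : TangentSpace 𝓘(ℂ, EX) (ι a)) :
    hι.lineCoord a₀ a (hι.toNormal a w) = hι.conormal a₀ a w := by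
  rw [lineCoord_apply ha, toLine_toNormal ha]

theorem mem_baseSet_tangent (ha : a ∈ hι.trivSet a₀) :
    a ∈ (trivializationAt EA (TangentSpace 𝓘(ℂ, EA) : A → Type) a₀).baseSet :=
  (interior_subset ha).1

theorem mem_baseSet_ambient (ha : a ∈ hι.trivSet a₀) :
    ι a ∈ (trivializationAt EX (TangentSpace 𝓘(ℂ, EX) : X → Type) (ι a₀)).baseSet :=
  (interior_subset ha).2.1

theorem frameMap_isInvertible (ha : a ∈ hι.trivSet a₀) : (hι.frameMap a₀ a).IsInvertible :=
  (interior_subset ha).2.2.2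

theorem coordA_injective (ha : a ∈ hι.trivSet a₀) : Function.Injective (coordA (EA := EA) a₀ a) :=
  Function.LeftInverse.injective
    (Trivialization.symmL_continuousLinearMapAt (R := ℂ) _ (mem_baseSet_tangent ha))

theorem coordX_injective (ha : a ∈ hι.trivSet a₀) : Function.Injective (coordX ι a₀ a) :=
  Function.LeftInverse.injective
    (Trivialization.symmL_continuousLinearMapAt (R := ℂ) _ (mem_baseSet_ambient ha))

theorem coordA_symmL (ha : a ∈ hι.trivSet a₀) (u : EA) : coordA a₀ a
    ((trivializationAt EA (TangentSpace 𝓘(ℂ, EA) : A → Type) a₀).symmL ℂ a u) = u :=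
  Trivialization.continuousLinearMapAt_symmL (R := ℂ) _ (mem_baseSet_tangent ha) u

theorem coordX_transverseField (ha : a ∈ hι.trivSet a₀) :
    coordX ι a₀ a (hι.transverseField a₀ a) = hι.frameMap a₀ a (0, 1) := by
  rw [coordX, transverseField, Trivialization.continuousLinearMapAt_symmL _ (mem_baseSet_ambient ha)]
  simp [frameMap]

theorem coordX_mfderiv (ha : a ∈ hι.trivSet a₀) (u : TangentSpace 𝓘(ℂ, EA) a) :
    coordX ι a₀ a (mfderiv 𝓘(ℂ, EA) 𝓘(ℂ, EX) ι a u) = hι.frameMap a₀ a (coordA a₀ a u, 0) := by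
  have h : hι.frameMap a₀ a (coordA a₀ a u, 0) = diffCoord ι a₀ a (coordA a₀ a u) := by
    simp [frameMap]
  rw [h, diffCoord_apply, coordA,
    Trivialization.symmL_continuousLinearMapAt (R := ℂ) _ (mem_baseSet_tangent ha)]
  rfl

theorem inverse_frameMap_coordX (ha : a ∈ hι.trivSet a₀) (w : TangentSpace 𝓘(ℂ, EX) (ι a)) :
    (hι.frameMap a₀ a).inverse (coordX ι a₀ a w) =
      (coordA a₀ a (hι.localRetraction a₀ a w), hι.conormal a₀ a w) := by
  refine Prod.ext ?_ rfl
  exact (coordA_symmL ha _).symm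

theorem coordX_eq_frameMap (ha : a ∈ hι.trivSet a₀) (w : TangentSpace 𝓘(ℂ, EX) (ι a)) :
    coordX ι a₀ a w = hι.frameMap a₀ a
      (coordA a₀ a (hι.localRetraction a₀ a w), hι.conormal a₀ a w) := by
  rw [← inverse_frameMap_coordX ha, (frameMap_isInvertible ha).self_apply_inverse]

theorem frameMap_injective (ha : a ∈ hι.trivSet a₀) : Function.Injective (hι.frameMap a₀ a) :=
  Function.LeftInverse.injective fun p ↦ (frameMap_isInvertible ha).inverse_apply_self p

theorem localRetraction_mfderiv (ha : a ∈ hι.trivSet a₀) (u : TangentSpace 𝓘(ℂ, EA) a) :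
    hι.localRetraction a₀ a (mfderiv 𝓘(ℂ, EA) 𝓘(ℂ, EX) ι a u) = u := by
  have := (coordX_eq_frameMap ha _).symm.trans (coordX_mfderiv ha u)
  exact coordA_injective ha (congrArg Prod.fst (frameMap_injective ha this))

theorem conormal_mfderiv (ha : a ∈ hι.trivSet a₀) (u : TangentSpace 𝓘(ℂ, EA) a) :
    hι.conormal a₀ a (mfderiv 𝓘(ℂ, EA) 𝓘(ℂ, EX) ι a u) = 0 :=
  (conormal_eq_zero_iff ha _).2 ⟨u, rfl⟩

theorem localRetraction_transverseField (ha : a ∈ hι.trivSet a₀) :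
    hι.localRetraction a₀ a (hι.transverseField a₀ a) = 0 := by
  have := (coordX_eq_frameMap ha _).symm.trans (coordX_transverseField ha)
  exact coordA_injective ha ((congrArg Prod.fst (frameMap_injective ha this)).trans
    (map_zero _).symm)

theorem conormal_transverseField (ha : a ∈ hι.trivSet a₀) :
    hι.conormal a₀ a (hι.transverseField a₀ a) = 1 :=
  congrArg Prod.snd (frameMap_injective ha
    ((coordX_eq_frameMap ha _).symm.trans (coordX_transverseField ha)))

/-- The decomposition of a tangent vector of `X` in the frame given by `TA` and the transverse
field. -/
theorem eq_mfderiv_add (ha : a ∈ hι.trivSet a₀) (w : TangentSpace 𝓘(ℂ, EX) (ι a)) :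
    w = mfderiv 𝓘(ℂ, EA) 𝓘(ℂ, EX) ι a (hι.localRetraction a₀ a w) +
      hι.conormal a₀ a w • hι.transverseField a₀ a := by
  apply coordX_injective ha
  rw [map_add, map_smul, coordX_mfderiv ha, coordX_transverseField ha, coordX_eq_frameMap ha w,
    ← map_smul, ← map_add]
  simp

/-! ### Holomorphy of the local frames and of contractions -/

variable (hι) in
/-- The contraction `N_a⁻¹ ⊗ T_aA → Hom(N_a, T_aA)`. -/
def contract (a : A) : hι.DualNormal a ⊗[ℂ] TangentSpace 𝓘(ℂ, EA) a →ₗ[ℂ]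
    hι.Normal a →ₗ[ℂ] TangentSpace 𝓘(ℂ, EA) a :=
  (dualTensorHom ℂ (hι.Normal a) (TangentSpace 𝓘(ℂ, EA) a)).comp
    (LinearMap.rTensor _ (ContinuousLinearMap.coeLM ℂ))

@[simp]
theorem contract_tmul {a : A} (φ : hι.DualNormal a) (u : TangentSpace 𝓘(ℂ, EA) a)
    (x : hι.Normal a) : hι.contract a (φ ⊗ₜ[ℂ] u) x = (φ x : ℂ) • u := rfl

/-- In the frame of `N⁻¹` at `a`, the section `lineCoord a₀` is the transition function of `N`. -/
theorem isHolomorphicSectionOn_lineCoord (a₀ : A) :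
    IsHolomorphicSectionOn EA (ℂ →L[ℂ] ℂ) hι.DualNormal
      (fun a ↦ (hι.lineCoord a₀ a : hι.DualNormal a)) (hι.trivSet a₀) := by
  intro a ha
  apply ContMDiffAt.contMDiffWithinAt
  rw [contMDiffAt_hom_bundle]
  refine ⟨contMDiffAt_id, ?_⟩
  have hU : hι.trivSet a ∩ hι.trivSet a₀ ∈ 𝓝 a :=
    (isOpen_interior.inter isOpen_interior).mem_nhds ⟨hι.mem_trivSet a, ha⟩
  refine ((hι.contMDiffOn_transition a a₀).contMDiffAt hU).congr_of_eventuallyEq ?_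
  filter_upwards [hU] with b hb
  ext
  rw [transition_apply hb, pretriv_symm hb.1, pretriv_apply]
  have h1 : (trivializationAt ℂ hι.Normal a).symmL ℂ b 1 = hι.ofLine a b 1 := by
    apply toLine_injective hb.1
    rw [toLine_ofLine hb.1, ← lineCoord_apply hb.1]
    exact Trivialization.continuousLinearMapAt_symmL (R := ℂ) _ hb.1 1
  rw [← lineCoord_apply hb.2, ← h1]
  simp only [ContinuousLinearMap.inCoordinates, ContinuousLinearMap.comp_apply]
  exact congrArg (fun L : ℂ →L[ℂ] ℂ ↦ L _)
    (Bundle.Trivial.continuousLinearMapAt_trivialization ℂ A ℂ b)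

theorem contMDiffOn_frameMap_inverse (a₀ : A) :
    ContMDiffOn 𝓘(ℂ, EA) 𝓘(ℂ, EX →L[ℂ] EA × ℂ) ω
      (fun a ↦ (hι.frameMap a₀ a).inverse) (hι.trivSet a₀) := by
  intro a ha
  exact ((frameMap_isInvertible ha).contDiffAt_map_inverse (n := ω)).contMDiffAt
    |>.comp_contMDiffWithinAt a (hι.contMDiffOn_frameMap a₀ a ha)

/-- In coordinates at `a₀`, this is the `TA`-component, in the frame at `a₀`, of a coordinate change of
`TX` applied to a constant vector. -/
theorem isHolomorphicSectionOn_localRetraction (a₀ a₁ : A) :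
    IsHolomorphicSectionOn EA EA (TangentSpace 𝓘(ℂ, EA) : A → Type)
      (fun a ↦ hι.localRetraction a₀ a (hι.transverseField a₁ a))
      (hι.trivSet a₀ ∩ hι.trivSet a₁) := by
  refine (Trivialization.contMDiffOn_section_iff
    (trivializationAt EA (TangentSpace 𝓘(ℂ, EA) : A → Type) a₀)
    (isOpen_interior.inter isOpen_interior) (fun a ha ↦ mem_baseSet_tangent ha.1)).2 ?_
  have h1 := (contMDiffOn_coordChangeL (n := ω) (IB := 𝓘(ℂ, EX))
      (trivializationAt EX (TangentSpace 𝓘(ℂ, EX) : X → Type) (ι a₁))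
      (trivializationAt EX (TangentSpace 𝓘(ℂ, EX) : X → Type) (ι a₀))).comp
    (ι.contMDiff.contMDiffOn (s := hι.trivSet a₀ ∩ hι.trivSet a₁))
    (fun a ha ↦ ⟨mem_baseSet_ambient ha.2, mem_baseSet_ambient ha.1⟩)
  have h2 := (hι.contMDiffOn_frameMap_inverse a₀).mono
    (Set.inter_subset_left (t := hι.trivSet a₁))
  have h3 := (contMDiffOn_const (c := ContinuousLinearMap.fst ℂ EA ℂ)).clm_apply
    (h2.clm_apply (h1.clm_apply (contMDiffOn_const (c := hι.transverse a₁))))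
  refine h3.congr fun a ha ↦ ?_
  have h4 : coordX ι a₀ a (hι.transverseField a₁ a) =
      (trivializationAt EX (TangentSpace 𝓘(ℂ, EX) : X → Type) (ι a₁)).coordChangeL ℂ
        (trivializationAt EX (TangentSpace 𝓘(ℂ, EX) : X → Type) (ι a₀)) (ι a)
        (hι.transverse a₁) := by
    rw [Trivialization.coordChangeL_apply _ _ ⟨mem_baseSet_ambient ha.2, mem_baseSet_ambient ha.1⟩,
      coordX, Trivialization.continuousLinearMapAt_apply,
      Trivialization.coe_linearMapAt_of_mem _ (mem_baseSet_ambient ha.1), transverseField,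
      Trivialization.symmL_apply _ (mem_baseSet_ambient ha.2)]
  have h5 := congrArg Prod.fst (inverse_frameMap_coordX ha.1 (hι.transverseField a₁ a))
  rw [h4] at h5
  refine Eq.trans ?_ h5.symm
  rw [coordA, Trivialization.continuousLinearMapAt_apply,
    Trivialization.coe_linearMapAt_of_mem _ (mem_baseSet_tangent ha.1)]

theorem isHolomorphicSectionOn_toNormal_transverseField (a₀ : A) :
    IsHolomorphicSectionOn EA ℂ hι.Normal
      (fun a ↦ hι.toNormal a (hι.transverseField a₀ a)) (hι.trivSet a₀) := by
  refine (Trivialization.contMDiffOn_section_iff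
    (trivializationAt ℂ hι.Normal a₀) isOpen_interior (fun a ha ↦ ha)).2 ?_
  refine (contMDiffOn_const (c := (1 : ℂ))).congr fun a ha ↦ ?_
  rw [trivializationAt_normal_apply, toLine_toNormal ha, conormal_transverseField ha]

/-- The contraction of a holomorphic section of `N⁻¹ ⊗ TA` with the class of the transverse field at
`a₀` is holomorphic in coordinates near `a₀`. -/
theorem exists_contMDiffAt_contract {U : Opens A}
    {t : ∀ a : U, hι.DualNormal a ⊗[ℂ] TangentSpace 𝓘(ℂ, EA) (a : A)}
    (ht : IsHolomorphicTensor EA (ℂ →L[ℂ] ℂ) hι.DualNormal EA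
      (TangentSpace 𝓘(ℂ, EA) : A → Type) U t) {a₀ : A} (h₀ : a₀ ∈ U) :
    ∃ h : A → EA, ContMDiffAt 𝓘(ℂ, EA) 𝓘(ℂ, EA) ω h a₀ ∧ ∃ O ∈ 𝓝 a₀, ∀ b : U, (b : A) ∈ O →
      coordA a₀ (b : A)
        (hι.contract b (t b) (hι.toNormal b (hι.transverseField a₀ b))) = h b := by
  obtain ⟨O, hO, k, φ, w, hφ, hw, h⟩ := ht ⟨a₀, h₀⟩
  have hn := (O.isOpen.inter (isOpen_interior (s := _))).mem_nhds ⟨hO, hι.mem_trivSet a₀⟩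
  refine ⟨fun b ↦ ∑ i, (φ i b (hι.toNormal b (hι.transverseField a₀ b)) : ℂ) •
    coordA a₀ b (w i b), ?_, O ∩ hι.trivSet a₀, hn, ?_⟩
  · refine contMDiffAt_finsetSum fun i _ ↦ ?_
    have h1 : ContMDiffAt 𝓘(ℂ, EA) 𝓘(ℂ, ℂ) ω
        (fun b ↦ (φ i b (hι.toNormal b (hι.transverseField a₀ b)) : ℂ)) a₀ := by
      have h1 := ((hφ i).contMDiffAt (O.isOpen.mem_nhds hO)).clm_bundle_apply
        ((isHolomorphicSectionOn_toNormal_transverseField (hι := hι) a₀).contMDiffAt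
          (isOpen_interior.mem_nhds (hι.mem_trivSet a₀)))
      exact (contMDiffAt_totalSpace.1 h1).2
    have h2 : ContMDiffAt 𝓘(ℂ, EA) 𝓘(ℂ, EA) ω (fun b ↦ coordA a₀ b (w i b)) a₀ := by
      have h2 := (contMDiffAt_totalSpace.1 ((hw i).contMDiffAt (O.isOpen.mem_nhds hO))).2
      refine h2.congr_of_eventuallyEq ?_
      filter_upwards [hn] with b hb
      rw [coordA, Trivialization.continuousLinearMapAt_apply,
        Trivialization.coe_linearMapAt_of_mem _ (mem_baseSet_tangent hb.2)]
    exact h1.smul h2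
  · intro b hb
    rw [h b hb.1]
    simp

/-! ### The global retraction -/

variable (hι) in
/-- The element of `N_a⁻¹ ⊗ T_aA` describing the difference of the two retractions
`localRetraction a a` and `localRetraction a₀ a` of `T_aX` onto `T_aA`, see
`localRetraction_self_apply`. It need not be continuous in `a`, because the retraction
`localRetraction a a` depends on the frame chosen at each point. -/
def splitTensor (a₀ a : A) : hι.DualNormal a ⊗[ℂ] TangentSpace 𝓘(ℂ, EA) a :=
  (hι.lineCoord a₀ a : hι.DualNormal a) ⊗ₜ[ℂ] hι.localRetraction a a (hι.transverseField a₀ a)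

/-- The set-theoretic retraction `localRetraction a a` drops out of the difference of two split
tensors, which is therefore holomorphic. -/
theorem splitTensor_sub {a₀ a₁ a : A} (h₀ : a ∈ hι.trivSet a₀) (h₁ : a ∈ hι.trivSet a₁) :
    hι.splitTensor a₀ a - hι.splitTensor a₁ a =
      (-hι.lineCoord a₁ a : hι.DualNormal a) ⊗ₜ[ℂ]
        hι.localRetraction a₀ a (hι.transverseField a₁ a) := by
  set c := hι.conormal a₀ a (hι.transverseField a₁ a)
  have h1 : hι.lineCoord a₀ a = c • hι.lineCoord a₁ a := by
    ext x
    obtain ⟨w, rfl⟩ := Submodule.mkQ_surjective _ x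
    change hι.lineCoord a₀ a (hι.toNormal a w) = c • hι.lineCoord a₁ a (hι.toNormal a w)
    rw [lineCoord_toNormal h₀, lineCoord_toNormal h₁]
    conv_lhs => rw [eq_mfderiv_add h₁ w]
    rw [map_add, map_smul, conormal_mfderiv h₀, zero_add, smul_eq_mul, smul_eq_mul, mul_comm]
  have h2 : hι.localRetraction a a (hι.transverseField a₁ a) =
      hι.localRetraction a₀ a (hι.transverseField a₁ a) +
        c • hι.localRetraction a a (hι.transverseField a₀ a) := by
    conv_lhs => rw [eq_mfderiv_add h₀ (hι.transverseField a₁ a)]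
    rw [map_add, map_smul, localRetraction_mfderiv (hι.mem_trivSet a)]
  rw [splitTensor, splitTensor, h1, h2, TensorProduct.tmul_add, TensorProduct.neg_tmul]
  erw [TensorProduct.smul_tmul]
  abel

theorem contract_sub {a : A} (t t' : hι.DualNormal a ⊗[ℂ] TangentSpace 𝓘(ℂ, EA) a)
    (x : hι.Normal a) :
    hι.contract a (t - t') x = hι.contract a t x - hι.contract a t' x := by
  -- Additivity suffices, and spares the expensive search for the group structure that `map_sub` needs.
  have h : hι.contract a (t - t' + t') x = hι.contract a (t - t') x + hι.contract a t' x :=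
    LinearMap.map_add₂ (hι.contract a) _ _ _
  have h' : t - t' + t' = t := sub_add_cancel t t'
  rw [← h', h, h']
  abel

/-- The difference of the two retractions of `T_aX` onto `T_aA` factors through `N_a`, as contraction
with the split tensor. -/
theorem localRetraction_self_apply {a₀ a : A} (h₀ : a ∈ hι.trivSet a₀)
    (w : TangentSpace 𝓘(ℂ, EX) (ι a)) :
    hι.localRetraction a a w = hι.localRetraction a₀ a w +
      hι.contract a (hι.splitTensor a₀ a) (hι.toNormal a w) := by
  conv_lhs => rw [eq_mfderiv_add h₀ w]
  rw [map_add, map_smul, localRetraction_mfderiv (hι.mem_trivSet a), splitTensor, contract_tmul,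
    lineCoord_toNormal h₀]

theorem toNormal_mfderiv (a : A) (u : TangentSpace 𝓘(ℂ, EA) a) :
    hι.toNormal a (mfderiv 𝓘(ℂ, EA) 𝓘(ℂ, EX) ι a u) = 0 :=
  (Submodule.Quotient.mk_eq_zero _).2 ⟨u, rfl⟩

/-- If `H¹(A, N⁻¹ ⊗ TA) = 0`, then `TA → TX|_A` has a global retraction which is holomorphic, in the
sense that its value on each local transverse field is holomorphic in coordinates. -/
theorem exists_retraction (hH : Subsingleton (Sheaf.H hι.dualNormalTensorTangent 1)) :
    ∃ R : ∀ a : A, TangentSpace 𝓘(ℂ, EX) (ι a) →ₗ[ℂ] TangentSpace 𝓘(ℂ, EA) a,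
      (∀ a u, R a (mfderiv 𝓘(ℂ, EA) 𝓘(ℂ, EX) ι a u) = u) ∧
      ∀ a₀, ContMDiffAt 𝓘(ℂ, EA) 𝓘(ℂ, EA) ω
        (fun a ↦ coordA a₀ a (R a (hι.transverseField a₀ a))) a₀ := by
  obtain ⟨d, hd⟩ := exists_global_tensor hH (fun a₀ : A ↦ ⟨hι.trivSet a₀, isOpen_interior⟩)
    (fun a ↦ ⟨a, hι.mem_trivSet a⟩) hι.splitTensor (fun a₀ a₁ a ↦ by
      refine ⟨⟨hι.trivSet a₀, isOpen_interior⟩ ⊓ ⟨hι.trivSet a₁, isOpen_interior⟩, a.2, 1,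
        fun _ b ↦ (-hι.lineCoord a₁ b : hι.DualNormal b),
        fun _ b ↦ hι.localRetraction a₀ b (hι.transverseField a₁ b), fun _ ↦ ?_, fun _ ↦ ?_, ?_⟩
      · exact ContMDiffOn.neg_section
          ((isHolomorphicSectionOn_lineCoord a₁).mono Set.inter_subset_right)
      · exact isHolomorphicSectionOn_localRetraction a₀ a₁
      · intro b hb
        rw [Fin.sum_univ_one]
        exact splitTensor_sub hb.1 hb.2)
  -- The discontinuous retraction `localRetraction a a`, corrected by the contraction of `d`.
  refine ⟨fun a ↦ (hι.localRetraction a a).toLinearMap -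
    (hι.contract a (d a)).comp (hι.toNormal a).toLinearMap, fun a u ↦ ?_, fun a₀ ↦ ?_⟩
  · change hι.localRetraction a a _ - hι.contract a (d a) (hι.toNormal a _) = u
    rw [localRetraction_mfderiv (hι.mem_trivSet a), toNormal_mfderiv, map_zero, sub_zero]
  · obtain ⟨h, hh, O, hO, hOh⟩ := exists_contMDiffAt_contract (hd a₀) (hι.mem_trivSet a₀)
    refine hh.neg.congr_of_eventuallyEq ?_
    filter_upwards [hO, isOpen_interior.mem_nhds (hι.mem_trivSet a₀)] with b hb hb'
    change _ = -h b
    rw [← hOh ⟨b, hb'⟩ hb]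
    change coordA a₀ b (hι.localRetraction b b _ - hι.contract b (d b) (hι.toNormal b _)) = _
    -- Near `a₀` this leaves the contraction of the holomorphic tensor `d - splitTensor a₀`.
    rw [localRetraction_self_apply hb', localRetraction_transverseField hb', zero_add, ← map_neg,
      contract_sub, neg_sub]

/-! ### The splitting of the tangent sequence -/

instance (a : A) : FiniteDimensional ℂ (TangentSpace 𝓘(ℂ, EX) (ι a)) :=
  inferInstanceAs (FiniteDimensional ℂ EX)

instance (a : A) : T2Space (TangentSpace 𝓘(ℂ, EX) (ι a)) := inferInstanceAs (T2Space EX)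

instance (a : A) : T2Space (TangentSpace 𝓘(ℂ, EA) a) := inferInstanceAs (T2Space EA)

variable (hι) in
theorem bijective_toNormal_prod {a : A} {R : TangentSpace 𝓘(ℂ, EX) (ι a) →ₗ[ℂ] TangentSpace 𝓘(ℂ, EA) a}
    (hR : ∀ u, R (mfderiv 𝓘(ℂ, EA) 𝓘(ℂ, EX) ι a u) = u) :
    Function.Bijective ((hι.toNormal a).toLinearMap.prod R) := by
  constructor
  · rw [injective_iff_map_eq_zero]
    intro w hw
    obtain ⟨u, rfl⟩ := (Submodule.Quotient.mk_eq_zero _).1 (congrArg Prod.fst hw)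
    have h2 : R (mfderiv 𝓘(ℂ, EA) 𝓘(ℂ, EX) ι a u) = 0 := congrArg Prod.snd hw
    rw [hR] at h2
    subst h2
    exact map_zero _
  · rintro ⟨x, u⟩
    obtain ⟨w, rfl⟩ := Submodule.mkQ_surjective _ x
    refine ⟨w + mfderiv 𝓘(ℂ, EA) 𝓘(ℂ, EX) ι a (u - R w), Prod.ext ?_ ?_⟩
    · change hι.toNormal a _ = hι.toNormal a w
      rw [map_add, toNormal_mfderiv, add_zero]
    · change R _ = u
      rw [map_add, hR, add_sub_cancel]

variable (hι) in
/-- The isomorphism `T_aX ≃ N_a × T_aA` given by the quotient map and a retraction `R` of the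
differential of `ι`. -/
def splittingEquiv (a : A) (R : TangentSpace 𝓘(ℂ, EX) (ι a) →ₗ[ℂ] TangentSpace 𝓘(ℂ, EA) a)
    (hR : ∀ u, R (mfderiv 𝓘(ℂ, EA) 𝓘(ℂ, EX) ι a u) = u) :
    TangentSpace 𝓘(ℂ, EX) (ι a) ≃L[ℂ] (hι.Normal a × TangentSpace 𝓘(ℂ, EA) a) :=
  (LinearEquiv.ofBijective _ (hι.bijective_toNormal_prod hR)).toContinuousLinearEquiv

/-- A retraction is determined in the frame at `a₀` by its value on the transverse field. -/
theorem coordA_retraction {a₀ a : A} (ha : a ∈ hι.trivSet a₀)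
    {R : TangentSpace 𝓘(ℂ, EX) (ι a) →ₗ[ℂ] TangentSpace 𝓘(ℂ, EA) a}
    (hR : ∀ u, R (mfderiv 𝓘(ℂ, EA) 𝓘(ℂ, EX) ι a u) = u) (w : TangentSpace 𝓘(ℂ, EX) (ι a)) :
    coordA a₀ a (R w) = ((hι.frameMap a₀ a).inverse (coordX ι a₀ a w)).1 +
      hι.conormal a₀ a w • coordA a₀ a (R (hι.transverseField a₀ a)) := by
  rw [inverse_frameMap_coordX ha]
  conv_lhs => rw [eq_mfderiv_add ha w]
  rw [map_add, map_smul, hR, map_add, map_smul]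

theorem trivializationAt_tangentRestrict_apply {a₀ a : A} (ha : a ∈ hι.trivSet a₀)
    (w : hι.TangentRestrict a) :
    (trivializationAt EX hι.TangentRestrict a₀ ⟨a, w⟩).2 = coordX ι a₀ a w := by
  rw [coordX, Trivialization.continuousLinearMapAt_apply,
    Trivialization.coe_linearMapAt_of_mem _ (mem_baseSet_ambient ha)]
  rfl

theorem trivializationAt_prod_apply {a₀ a : A} (ha : a ∈ hι.trivSet a₀)
    (x : hι.Normal a) (u : TangentSpace 𝓘(ℂ, EA) a) :
    (trivializationAt (ℂ × EA) (hι.Normal ×ᵇ (TangentSpace 𝓘(ℂ, EA) : A → Type)) a₀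
      ⟨a, (x, u)⟩).2 = (hι.lineCoord a₀ a x, coordA a₀ a u) := by
  rw [coordA, Trivialization.continuousLinearMapAt_apply,
    Trivialization.coe_linearMapAt_of_mem _ (mem_baseSet_tangent ha), lineCoord_apply ha]
  rfl

/-- The isomorphism `w ↦ (q w, R w)` in coordinates at `a₀`: if `w` has coordinates `(u, c)` in the
frame given by `TA` and the transverse field `v`, then `R w` has coordinates `u + c • R v`. -/
theorem trivializationAt_prod_splittingEquiv {a₀ a : A} (ha : a ∈ hι.trivSet a₀)
    (R : TangentSpace 𝓘(ℂ, EX) (ι a) →ₗ[ℂ] TangentSpace 𝓘(ℂ, EA) a)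
    (hR : ∀ u, R (mfderiv 𝓘(ℂ, EA) 𝓘(ℂ, EX) ι a u) = u) (w : TangentSpace 𝓘(ℂ, EX) (ι a)) :
    (trivializationAt (ℂ × EA) (hι.Normal ×ᵇ (TangentSpace 𝓘(ℂ, EA) : A → Type)) a₀
      ⟨a, hι.splittingEquiv a R hR w⟩).2 =
    (((hι.frameMap a₀ a).inverse (trivializationAt EX hι.TangentRestrict a₀ ⟨a, w⟩).2).2,
      ((hι.frameMap a₀ a).inverse (trivializationAt EX hι.TangentRestrict a₀ ⟨a, w⟩).2).1 +
      ((hι.frameMap a₀ a).inverse (trivializationAt EX hι.TangentRestrict a₀ ⟨a, w⟩).2).2 •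
        coordA a₀ a (R (hι.transverseField a₀ a))) := by
  refine (trivializationAt_prod_apply ha (hι.toNormal a w) (R w)).trans ?_
  rw [lineCoord_toNormal ha, coordA_retraction ha hR,
    trivializationAt_tangentRestrict_apply ha w, inverse_frameMap_coordX ha]

/-- The inverse of `w ↦ (q w, R w)` in coordinates at `a₀`: the vector with image `(c, u)` has
coordinates `(u - c • R v, c)` in the frame given by `TA` and the transverse field `v`. -/
theorem trivializationAt_tangentRestrict_splittingEquiv_symm {a₀ a : A} (ha : a ∈ hι.trivSet a₀)
    (R : TangentSpace 𝓘(ℂ, EX) (ι a) →ₗ[ℂ] TangentSpace 𝓘(ℂ, EA) a)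
    (hR : ∀ u, R (mfderiv 𝓘(ℂ, EA) 𝓘(ℂ, EX) ι a u) = u)
    (z : hι.Normal a × TangentSpace 𝓘(ℂ, EA) a) :
    (trivializationAt EX hι.TangentRestrict a₀ ⟨a, (hι.splittingEquiv a R hR).symm z⟩).2 =
    hι.frameMap a₀ a ((trivializationAt (ℂ × EA)
        (hι.Normal ×ᵇ (TangentSpace 𝓘(ℂ, EA) : A → Type)) a₀ ⟨a, z⟩).2.2 -
      (trivializationAt (ℂ × EA) (hι.Normal ×ᵇ (TangentSpace 𝓘(ℂ, EA) : A → Type)) a₀ ⟨a, z⟩).2.1 •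
        coordA a₀ a (R (hι.transverseField a₀ a)),
      (trivializationAt (ℂ × EA)
        (hι.Normal ×ᵇ (TangentSpace 𝓘(ℂ, EA) : A → Type)) a₀ ⟨a, z⟩).2.1) := by
  obtain ⟨w, rfl⟩ := (hι.splittingEquiv a R hR).surjective z
  rw [ContinuousLinearEquiv.symm_apply_apply, trivializationAt_prod_splittingEquiv ha,
    add_sub_cancel_right, Prod.mk.eta, (frameMap_isInvertible ha).self_apply_inverse]

/-- The isomorphism `TX|_A ≅ N ⊕ TA` given by a holomorphic retraction `R : TX|_A → TA`. Holomorphy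
of `R` is only required for its value on the transverse field at each `a₀`, which determines `R`
because `R` is the identity on `TA`. -/
def splittingIso (R : ∀ a : A, TangentSpace 𝓘(ℂ, EX) (ι a) →ₗ[ℂ] TangentSpace 𝓘(ℂ, EA) a)
    (hR : ∀ a u, R a (mfderiv 𝓘(ℂ, EA) 𝓘(ℂ, EX) ι a u) = u)
    (hRω : ∀ a₀, ContMDiffAt 𝓘(ℂ, EA) 𝓘(ℂ, EA) ω
      (fun a ↦ coordA a₀ a (R a (hι.transverseField a₀ a))) a₀) :
    HolomorphicBundleIso EA EX hι.TangentRestrict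
      (ℂ × EA) (hι.Normal ×ᵇ (TangentSpace 𝓘(ℂ, EA) : A → Type)) where
  fiber a := hι.splittingEquiv a (R a) (hR a)
  holomorphic := by
    intro p
    rw [contMDiffAt_totalSpace]
    set a₀ := p.1
    have hp := contMDiffAt_totalSpace.1
      (contMDiffAt_id (I := 𝓘(ℂ, EA).prod 𝓘(ℂ, EX)) (n := ω) (x := p))
    have hn : ∀ᶠ q in 𝓝 p, q.1 ∈ hι.trivSet a₀ :=
      hp.1.continuousAt (isOpen_interior.mem_nhds (hι.mem_trivSet a₀))
    have hinv := (((hι.contMDiffOn_frameMap_inverse a₀).contMDiffAt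
      (isOpen_interior.mem_nhds (hι.mem_trivSet a₀))).comp p hp.1).clm_apply hp.2
    have h1 := (contMDiffAt_const (c := ContinuousLinearMap.fst ℂ EA ℂ)).clm_apply hinv
    have h2 := (contMDiffAt_const (c := ContinuousLinearMap.snd ℂ EA ℂ)).clm_apply hinv
    refine ⟨hp.1, (h2.prodMk_space
      (h1.add (h2.smul ((hRω a₀).comp p hp.1)))).congr_of_eventuallyEq ?_⟩
    filter_upwards [hn] with q hq
    exact trivializationAt_prod_splittingEquiv hq (R q.1) (hR q.1) q.2
  holomorphic_symm := by
    intro p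
    rw [contMDiffAt_totalSpace]
    set a₀ := p.1
    have hp := contMDiffAt_totalSpace.1
      (contMDiffAt_id (I := 𝓘(ℂ, EA).prod 𝓘(ℂ, ℂ × EA)) (n := ω) (x := p))
    have hn : ∀ᶠ q in 𝓝 p, q.1 ∈ hι.trivSet a₀ :=
      hp.1.continuousAt (isOpen_interior.mem_nhds (hι.mem_trivSet a₀))
    have h1 := (contMDiffAt_const (c := ContinuousLinearMap.fst ℂ ℂ EA)).clm_apply hp.2
    have h2 := (contMDiffAt_const (c := ContinuousLinearMap.snd ℂ ℂ EA)).clm_apply hp.2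
    have h3 := (((hι.contMDiffOn_frameMap a₀).contMDiffAt
      (isOpen_interior.mem_nhds (hι.mem_trivSet a₀))).comp p hp.1).clm_apply
      ((h2.sub (h1.smul ((hRω a₀).comp p hp.1))).prodMk_space h1)
    refine ⟨hp.1, h3.congr_of_eventuallyEq ?_⟩
    filter_upwards [hn] with q hq
    exact trivializationAt_tangentRestrict_splittingEquiv_symm hq (R q.1) (hR q.1) q.2

end IsHypersurface

end Splitting

end

theorem proposition4
    {EX EA : Type} [NormedAddCommGroup EX] [NormedSpace ℂ EX] [FiniteDimensional ℂ EX]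
    [NormedAddCommGroup EA] [NormedSpace ℂ EA] [FiniteDimensional ℂ EA]
    {X : Type v} [TopologicalSpace X] [ChartedSpace EX X] [IsManifold 𝓘(ℂ, EX) ω X]
    {A : Type u} [TopologicalSpace A] [ChartedSpace EA A] [IsManifold 𝓘(ℂ, EA) ω A]
    (ι : ContMDiffMap 𝓘(ℂ, EA) 𝓘(ℂ, EX) A X ω) (hι : IsHypersurface ι)
    (hH : Subsingleton (Sheaf.H hι.dualNormalTensorTangent 1)) :
    ∃ Φ : HolomorphicBundleIso EA EX hι.TangentRestrict
        (ℂ × EA) (hι.Normal ×ᵇ (TangentSpace 𝓘(ℂ, EA) : A → Type)),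
      (∀ (a : A) (w : TangentSpace 𝓘(ℂ, EX) (ι a)), (Φ.fiber a w).1 = hι.toNormal a w) ∧
      (∀ (a : A) (v : TangentSpace 𝓘(ℂ, EA) a),
        Φ.fiber a (mfderiv 𝓘(ℂ, EA) 𝓘(ℂ, EX) ι a v) = (0, v)) := by
  obtain ⟨R, hR, hRω⟩ := IsHypersurface.exists_retraction hH
  exact ⟨IsHypersurface.splittingIso R hR hRω, fun _ _ ↦ rfl,
    fun a v ↦ Prod.ext (IsHypersurface.toNormal_mfderiv a v) (hR a v)⟩
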